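/- There are absolute constants $c, C > 0$ such that the following holds. Let $G = (V,E)$ be any finite simple undirected graph on $n$ vertices, and let $k \ge 1$ be an integer with $k \ge c \log n$. Let $G'$ be a random $k$-out subgraph of $G$: each vertex $v$, independently of the other vertices, chooses a uniformly random set of $\min\{k, \deg(v)\}$ of its incident edges, and $G' = (V,S)$, where $S$ is the set of edges chosen by at least one of their endpoints. Then the expected number of edges of $G$ that join different connected components of $G'$ is at most $C\, n/k$. -/

import Mathlib

open MeasureTheory

/-- The finite type of sets of edges carries the discrete σ-algebra. -/
instance instMeasurableSpaceFinsetSym2 {V : Type*} : MeasurableSpace (Finset (Sym2 V)) := ⊤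

namespace SimpleGraph

/-- The sets of `min {k, deg v}` edges incident with `v`: the possible choices of the vertex `v`. -/
def kOutChoices {V : Type*} [Fintype V] [DecidableEq V] (G : SimpleGraph V)
    [DecidableRel G.Adj] (k : ℕ) (v : V) : Finset (Finset (Sym2 V)) :=
  (G.incidenceFinset v).powersetCard (min k (G.degree v))

theorem kOutChoices_nonempty {V : Type*} [Fintype V] [DecidableEq V] (G : SimpleGraph V)
    [DecidableRel G.Adj] (k : ℕ) (v : V) : (G.kOutChoices k v).Nonempty := by
  unfold kOutChoices
  rw [Finset.powersetCard_nonempty, card_incidenceFinset_eq_degree]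
  exact min_le_right _ _

/-- The law of the choices of all the vertices: every vertex `v` independently chooses a uniformly
random set of `min {k, deg v}` incident edges. -/
noncomputable def kOutMeasure {V : Type*} [Fintype V] [DecidableEq V] (G : SimpleGraph V)
    [DecidableRel G.Adj] (k : ℕ) : Measure (V → Finset (Sym2 V)) :=
  Measure.pi fun v => (PMF.uniformOfFinset (G.kOutChoices k v) (G.kOutChoices_nonempty k v)).toMeasure

/-- The spanning subgraph of `G` determined by the choices `S` of the vertices: an edge of `G` is kept
if and only if it was chosen by at least one of its endpoints. -/
def outSubgraph {V : Type*} (G : SimpleGraph V) (S : V → Finset (Sym2 V)) : SimpleGraph V :=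
  fromEdgeSet {e | e ∈ G.edgeSet ∧ ∃ v ∈ e, e ∈ S v}

/-- The edges of `G` that join different connected components of `H`. -/
def interComponentEdges {V : Type*} (G H : SimpleGraph V) : Set (Sym2 V) :=
  {e | e ∈ G.edgeSet ∧
    ∃ u v, e = s(u, v) ∧ H.connectedComponentMk u ≠ H.connectedComponentMk v}

/-- The expected number of edges of `G` that join different connected components of a random
`k`-out subgraph of `G`. -/
noncomputable def expectedInterComponentEdges {V : Type*} [Fintype V] [DecidableEq V]
    (G : SimpleGraph V) [DecidableRel G.Adj] (k : ℕ) : ℝ :=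
  ∫ S, ((G.interComponentEdges (G.outSubgraph S)).ncard : ℝ) ∂(G.kOutMeasure k)

end SimpleGraph

/-!
The choices are revealed one edge at a time, while a potential `Ψ` of the current subgraph `H` is
watched: the sum over the components of `H` of the largest degree in `G` of a vertex of the component.

If `e = vu` joins different components of `H` and `deg v ≤ deg u`, then adding `e` merges two
components whose largest degrees are at least `deg v`, so `Ψ` drops by at least `deg v`
(`potential_add_degree_le`). The next edge chosen by `v` is `e` with probability at least `1 / deg v`.
Hence the expected drop of `Ψ` caused by the next choice of `v` is at least the number of such edges
at `v` (`outMean_update_potential_add_le`), and in a round in which every vertex chooses one more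
edge, the expected drop is at least the expected value, after the round, of the total number `y` of
such pairs `(v, u)` (`outMean_succ_potential_add_le`). Every inter-component edge is counted in `y`.

On the other hand, a vertex of largest degree `d` in a component with `s` vertices has at least `d - s`
neighbours outside the component, so that `Ψ ≤ 2 y + n` (`potential_le_two_mul_sum_outerNeighbors`).
The expectations `a t` and `x t` of `Ψ` and `y` after `t` rounds thus satisfy
`a (t + 1) + x (t + 1) ≤ a t` and `a t ≤ 2 * x t + n`. The excess `a t - n`, at most `n ^ 2` at the
beginning, shrinks by a factor `2 / 3` in each round, which makes `a (k / 2) ≤ 2 * n` once `k` is a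
large multiple of `log n`. As `x` is decreasing, the remaining `k / 2` rounds give
`(k / 2) * x k ≤ a (k / 2) ≤ 2 * n` (`le_four_mul_div_of_potential`).
-/

namespace SimpleGraph

/-! ### Leaders of connected components -/

section Leaders

variable {V : Type*} [Fintype V] (G : SimpleGraph V) [DecidableRel G.Adj]

/-- A linear order on the vertices that refines the comparison of degrees: ties are broken by an
arbitrary numbering of the vertices. -/
noncomputable def degreeRank (v : V) : ℕ ×ₗ Fin (Fintype.card V) :=
  toLex (G.degree v, Fintype.equivFin V v)

theorem degreeRank_injective : Function.Injective G.degreeRank := by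
  intro u v h
  have := congrArg (fun x => (ofLex x).2) h
  simpa [degreeRank] using this

theorem degree_le_of_degreeRank_le {u v : V} (h : G.degreeRank u ≤ G.degreeRank v) :
    G.degree u ≤ G.degree v := by
  rw [degreeRank, degreeRank, Prod.Lex.toLex_le_toLex] at h
  rcases h with h | h
  · exact h.le
  · exact h.1.le

open scoped Classical in
/-- The leaders of `H`: every connected component of `H` has exactly one, its vertex of largest
`degreeRank`, which has the largest degree in `G` among the vertices of the component. -/
noncomputable def leaders (H : SimpleGraph V) : Finset V :=
  Finset.univ.filter fun v => ∀ u, H.Reachable v u → G.degreeRank u ≤ G.degreeRank v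

theorem mem_leaders {H : SimpleGraph V} {v : V} :
    v ∈ G.leaders H ↔ ∀ u, H.Reachable v u → G.degreeRank u ≤ G.degreeRank v := by
  simp [leaders]

theorem leaders_anti {H H' : SimpleGraph V} (h : H ≤ H') : G.leaders H' ⊆ G.leaders H := by
  intro v hv
  rw [mem_leaders] at hv ⊢
  exact fun u hu => hv u (hu.mono h)

theorem exists_leader (H : SimpleGraph V) (v : V) :
    ∃ l ∈ G.leaders H, H.Reachable v l ∧ G.degree v ≤ G.degree l := by
  classical
  obtain ⟨l, hl, hmax⟩ := (Finset.univ.filter fun u => H.Reachable v u).exists_max_image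
    G.degreeRank ⟨v, by simp⟩
  simp only [Finset.mem_filter, Finset.mem_univ, true_and] at hl hmax
  exact ⟨l, (mem_leaders G).2 fun u hu => hmax u (hl.trans hu), hl,
    G.degree_le_of_degreeRank_le (hmax v (Reachable.refl v))⟩

theorem leader_unique {H : SimpleGraph V} {l l' : V} (hl : l ∈ G.leaders H)
    (hl' : l' ∈ G.leaders H) (h : H.Reachable l l') : l = l' :=
  G.degreeRank_injective
    (le_antisymm ((mem_leaders G).1 hl' l h.symm) ((mem_leaders G).1 hl l' h))

/-- The potential of `H`: the sum over the connected components of `H` of the largest degree in `G`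
of a vertex of the component. -/
noncomputable def potential (H : SimpleGraph V) : ℝ :=
  ∑ v ∈ G.leaders H, (G.degree v : ℝ)

theorem potential_nonneg (H : SimpleGraph V) : 0 ≤ G.potential H :=
  Finset.sum_nonneg fun _ _ => Nat.cast_nonneg _

theorem potential_anti {H H' : SimpleGraph V} (h : H ≤ H') : G.potential H' ≤ G.potential H :=
  Finset.sum_le_sum_of_subset_of_nonneg (G.leaders_anti h) fun _ _ _ => Nat.cast_nonneg _

theorem potential_le_sq (H : SimpleGraph V) :
    G.potential H ≤ (Fintype.card V : ℝ) * Fintype.card V := by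
  refine (Finset.sum_le_card_nsmul _ _ (Fintype.card V : ℝ) fun v _ => ?_).trans ?_
  · exact_mod_cast (G.degree_lt_card_verts v).le
  · rw [nsmul_eq_mul]
    exact mul_le_mul_of_nonneg_right (by exact_mod_cast Finset.card_le_univ _) (Nat.cast_nonneg _)

/-- Of the leaders of two components that get merged, at most one remains a leader. -/
theorem potential_add_degree_le {H H' : SimpleGraph V} (h : H ≤ H') {v u : V}
    (hd : G.degree v ≤ G.degree u) (hH : ¬ H.Reachable v u) (hH' : H'.Reachable v u) :
    G.potential H' + G.degree v ≤ G.potential H := by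
  classical
  obtain ⟨a, ha, hva, hda⟩ := G.exists_leader H v
  obtain ⟨b, hb, hub, hdb⟩ := G.exists_leader H u
  have hab : a ≠ b := by
    rintro rfl
    exact hH (hva.trans hub.symm)
  have hreach : H'.Reachable a b := ((hva.mono h).symm.trans hH').trans (hub.mono h)
  obtain ⟨w, hw, hw', hdw⟩ : ∃ w ∈ G.leaders H, w ∉ G.leaders H' ∧ G.degree v ≤ G.degree w := by
    by_cases ha' : a ∈ G.leaders H'
    · exact ⟨b, hb, fun hb' => hab (G.leader_unique ha' hb' hreach), hd.trans hdb⟩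
    · exact ⟨a, ha, ha', hda⟩
  have hsub : insert w (G.leaders H') ⊆ G.leaders H :=
    Finset.insert_subset hw (G.leaders_anti h)
  have hsum := Finset.sum_le_sum_of_subset_of_nonneg (f := fun v => (G.degree v : ℝ)) hsub
    fun _ _ _ => Nat.cast_nonneg _
  rw [Finset.sum_insert hw'] at hsum
  have : (G.degree v : ℝ) ≤ G.degree w := by exact_mod_cast hdw
  unfold potential
  linarith

/-! ### Inter-component edges seen from their endpoint of smaller degree -/

open scoped Classical in
/-- The neighbours of `v` in `G` that lie in another connected component of `H` and have at least
the degree of `v`. -/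
noncomputable def outerNeighbors (H : SimpleGraph V) (v : V) : Finset V :=
  (G.neighborFinset v).filter fun u => ¬ H.Reachable v u ∧ G.degree v ≤ G.degree u

theorem mem_outerNeighbors {H : SimpleGraph V} {v u : V} :
    u ∈ G.outerNeighbors H v ↔ G.Adj v u ∧ ¬ H.Reachable v u ∧ G.degree v ≤ G.degree u := by
  simp [outerNeighbors]

theorem outerNeighbors_anti {H H' : SimpleGraph V} (h : H ≤ H') (v : V) :
    G.outerNeighbors H' v ⊆ G.outerNeighbors H v := by
  intro u hu
  rw [mem_outerNeighbors] at hu ⊢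
  exact ⟨hu.1, fun hr => hu.2.1 (hr.mono h), hu.2.2⟩

theorem ncard_interComponentEdges_le (H : SimpleGraph V) :
    (G.interComponentEdges H).ncard ≤ ∑ v, (G.outerNeighbors H v).card := by
  classical
  rw [← Finset.card_sigma]
  have hsub : G.interComponentEdges H ⊆
      (((Finset.univ : Finset V).sigma fun v => G.outerNeighbors H v).image
        fun p => s(p.1, p.2) : Finset (Sym2 V)) := by
    rintro e ⟨he, u, v, rfl, huv⟩
    rw [mem_edgeSet] at he
    rw [Ne, ConnectedComponent.eq] at huv
    simp only [Finset.coe_image, Set.mem_image, Finset.mem_coe, Finset.mem_sigma,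
      Finset.mem_univ, true_and, mem_outerNeighbors]
    rcases le_total (G.degree u) (G.degree v) with hd | hd
    · exact ⟨⟨u, v⟩, ⟨he, huv, hd⟩, rfl⟩
    · exact ⟨⟨v, u⟩, ⟨he.symm, fun h => huv h.symm, hd⟩, Sym2.eq_swap⟩
  refine (Set.ncard_le_ncard hsub (Finset.finite_toSet _)).trans ?_
  rw [Set.ncard_coe_finset]
  exact Finset.card_image_le

open scoped Classical in
theorem sum_leaders_card_component_le (H : SimpleGraph V) :
    ∑ l ∈ G.leaders H, (Finset.univ.filter fun u => H.Reachable l u).card ≤ Fintype.card V := by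
  rw [← Finset.card_biUnion]
  · exact Finset.card_le_univ _
  · intro l hl l' hl' hne
    rw [Function.onFun, Finset.disjoint_left]
    intro u hu hu'
    simp only [Finset.mem_filter, Finset.mem_univ, true_and] at hu hu'
    exact hne (G.leader_unique hl hl' (hu.trans hu'.symm))

/-- A leader of degree `d` whose component has `s` vertices has at least `d - s` neighbours outside
its component. -/
theorem potential_le_two_mul_sum_outerNeighbors (H : SimpleGraph V) :
    G.potential H ≤ 2 * ∑ v, ((G.outerNeighbors H v).card : ℝ) + Fintype.card V := by
  classical
  set N : V → Finset V := fun v => (G.neighborFinset v).filter fun u => ¬ H.Reachable v u with hN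
  have hdeg : ∀ v, G.degree v ≤ (N v).card + (Finset.univ.filter fun u => H.Reachable v u).card := by
    intro v
    rw [← card_neighborFinset_eq_degree,
      ← Finset.card_filter_add_card_filter_not (s := G.neighborFinset v) (fun u => H.Reachable v u),
      add_comm]
    exact Nat.add_le_add_left
      (Finset.card_le_card (Finset.filter_subset_filter _ (Finset.subset_univ _))) _
  have hpot : ∑ v ∈ G.leaders H, G.degree v ≤ ∑ v, (N v).card + Fintype.card V := by
    refine (Finset.sum_le_sum fun v _ => hdeg v).trans ?_
    rw [Finset.sum_add_distrib]
    exact add_le_add (Finset.sum_le_sum_of_subset (Finset.subset_univ _))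
      (G.sum_leaders_card_component_le H)
  -- Every ordered pair counted on the left is, in one of its two orders, counted on the right.
  have htwo : ∑ v, (N v).card ≤ 2 * ∑ v, (G.outerNeighbors H v).card := by
    rw [← Finset.card_sigma, ← Finset.card_sigma, two_mul]
    set Y := (Finset.univ : Finset V).sigma fun v => G.outerNeighbors H v with hY
    have hsub : ((Finset.univ : Finset V).sigma N) ⊆
        Y ∪ Y.image (fun p => ⟨p.2, p.1⟩) := by
      rintro ⟨v, u⟩ hp
      simp only [hN, Finset.mem_sigma, Finset.mem_univ, true_and, Finset.mem_filter,
        mem_neighborFinset] at hp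
      simp only [hY, Finset.mem_union, Finset.mem_image, Finset.mem_sigma, Finset.mem_univ,
        true_and, mem_outerNeighbors]
      rcases le_total (G.degree v) (G.degree u) with hd | hd
      · exact Or.inl ⟨hp.1, hp.2, hd⟩
      · exact Or.inr ⟨⟨u, v⟩, ⟨hp.1.symm, fun h => hp.2 h.symm, hd⟩, rfl⟩
    refine (Finset.card_le_card hsub).trans ((Finset.card_union_le _ _).trans ?_)
    exact Nat.add_le_add_left Finset.card_image_le _
  unfold potential
  exact_mod_cast hpot.trans (Nat.add_le_add_right htwo _)

end Leaders

/-! ### Averages over choices of prescribed sizes -/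

section Mean

variable {V : Type*} [Fintype V] [DecidableEq V] (G : SimpleGraph V) [DecidableRel G.Adj]

/-- The possible joint choices of the vertices if every vertex `v` chooses `min {m v, deg v}` of its
incident edges. -/
def outChoices (m : V → ℕ) : Finset (V → Finset (Sym2 V)) :=
  Fintype.piFinset fun v => G.kOutChoices (m v) v

theorem mem_outChoices {m : V → ℕ} {S : V → Finset (Sym2 V)} : S ∈ G.outChoices m ↔
    ∀ v, S v ⊆ G.incidenceFinset v ∧ (S v).card = min (m v) (G.degree v) := by
  simp [outChoices, kOutChoices, Finset.mem_powersetCard]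

theorem outChoices_nonempty (m : V → ℕ) : (G.outChoices m).Nonempty :=
  Fintype.piFinset_nonempty.2 fun v => G.kOutChoices_nonempty (m v) v

theorem outChoices_update_of_degree_le {m : V → ℕ} {v : V} (hv : G.degree v ≤ m v) :
    G.outChoices (Function.update m v (m v + 1)) = G.outChoices m := by
  ext S
  simp only [mem_outChoices]
  refine forall_congr' fun w => ?_
  rcases eq_or_ne w v with rfl | hw
  · rw [Function.update_self, min_eq_right hv, min_eq_right (hv.trans (Nat.le_succ _))]
  · rw [Function.update_of_ne hw]

/-- The mean of `f` over uniformly random choices of sizes given by `m`. -/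
noncomputable def outMean (m : V → ℕ) (f : (V → Finset (Sym2 V)) → ℝ) : ℝ :=
  (∑ S ∈ G.outChoices m, f S) / (G.outChoices m).card

theorem outMean_mono {m : V → ℕ} {f g : (V → Finset (Sym2 V)) → ℝ}
    (h : ∀ S ∈ G.outChoices m, f S ≤ g S) : G.outMean m f ≤ G.outMean m g :=
  div_le_div_of_nonneg_right (Finset.sum_le_sum h) (Nat.cast_nonneg _)

theorem outMean_const (m : V → ℕ) (r : ℝ) : G.outMean m (fun _ => r) = r := by
  have : ((G.outChoices m).card : ℝ) ≠ 0 := by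
    exact_mod_cast (G.outChoices_nonempty m).card_ne_zero
  rw [outMean, Finset.sum_const, nsmul_eq_mul, mul_div_cancel_left₀ _ this]

theorem outMean_add (m : V → ℕ) (f g : (V → Finset (Sym2 V)) → ℝ) :
    G.outMean m (fun S => f S + g S) = G.outMean m f + G.outMean m g := by
  simp only [outMean, Finset.sum_add_distrib, add_div]

theorem outMean_const_mul (m : V → ℕ) (r : ℝ) (f : (V → Finset (Sym2 V)) → ℝ) :
    G.outMean m (fun S => r * f S) = r * G.outMean m f := by
  simp only [outMean, ← Finset.mul_sum, mul_div_assoc]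

theorem outMean_sum (m : V → ℕ) {ι : Type*} (s : Finset ι) (f : ι → (V → Finset (Sym2 V)) → ℝ) :
    G.outMean m (fun S => ∑ i ∈ s, f i S) = ∑ i ∈ s, G.outMean m (f i) := by
  simp only [outMean]
  rw [Finset.sum_comm, Finset.sum_div]

/-- Sampling without replacement: a choice in which `v` has one more edge arises from a smaller
choice and a new edge of `v` in `m v + 1` ways. -/
theorem sum_outChoices_insert {m : V → ℕ} {v : V} (hv : m v < G.degree v)
    (g : (V → Finset (Sym2 V)) → ℝ) :
    ∑ S ∈ G.outChoices m, ∑ e ∈ G.incidenceFinset v \ S v,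
        g (Function.update S v (insert e (S v))) =
      (m v + 1) * ∑ S ∈ G.outChoices (Function.update m v (m v + 1)), g S := by
  have hcard : ∀ S ∈ G.outChoices (Function.update m v (m v + 1)),
      (m v + 1) * g S = ∑ _e ∈ S v, g S := by
    intro S hS
    have h := ((G.mem_outChoices).1 hS v).2
    rw [Function.update_self, min_eq_left hv] at h
    rw [Finset.sum_const, h, nsmul_eq_mul]
    push_cast
    ring
  rw [Finset.mul_sum, Finset.sum_congr rfl hcard, Finset.sum_sigma', Finset.sum_sigma']
  refine Finset.sum_bij' (fun p _ => ⟨Function.update p.1 v (insert p.2 (p.1 v)), p.2⟩)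
    (fun p _ => ⟨Function.update p.1 v ((p.1 v).erase p.2), p.2⟩) ?_ ?_ ?_ ?_ ?_
  · rintro ⟨S, e⟩ hp
    simp only [Finset.mem_sigma, Finset.mem_sdiff, mem_outChoices] at hp ⊢
    obtain ⟨hS, he, heS⟩ := hp
    refine ⟨fun w => ?_, by simp⟩
    rcases eq_or_ne w v with rfl | hw
    · simp only [Function.update_self]
      refine ⟨Finset.insert_subset he (hS w).1, ?_⟩
      rw [Finset.card_insert_of_notMem heS, (hS w).2]
      omega
    · simpa only [Function.update_of_ne hw] using hS w
  · rintro ⟨S, e⟩ hp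
    simp only [Finset.mem_sigma, Finset.mem_sdiff, mem_outChoices] at hp ⊢
    obtain ⟨hS, he⟩ := hp
    refine ⟨fun w => ?_, (hS v).1 he, by simp⟩
    rcases eq_or_ne w v with rfl | hw
    · simp only [Function.update_self]
      refine ⟨(Finset.erase_subset _ _).trans (hS w).1, ?_⟩
      rw [Finset.card_erase_of_mem he, (hS w).2, Function.update_self]
      omega
    · simpa only [Function.update_of_ne hw] using hS w
  · rintro ⟨S, e⟩ hp
    simp only [Finset.mem_sigma, Finset.mem_sdiff] at hp
    simp [Finset.erase_insert hp.2.2]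
  · rintro ⟨S, e⟩ hp
    simp only [Finset.mem_sigma] at hp
    simp [Finset.insert_erase hp.2]
  · rintro ⟨S, e⟩ _
    rfl

/-- If a new random edge of `v` lowers `f` by at least `y` on average, then so does increasing
the size of the choice of `v` by one. -/
theorem outMean_update_add_le {m : V → ℕ} {v : V} (hv : m v < G.degree v)
    {f y : (V → Finset (Sym2 V)) → ℝ} (hy : ∀ S, 0 ≤ y S)
    (hstep : ∀ S ∈ G.outChoices m, G.degree v * y S ≤ ∑ e ∈ G.incidenceFinset v \ S v,
      (f S - f (Function.update S v (insert e (S v))))) :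
    G.outMean (Function.update m v (m v + 1)) f + G.outMean m y ≤ G.outMean m f := by
  set m' := Function.update m v (m v + 1)
  have hrest : ∀ S ∈ G.outChoices m,
      ((G.incidenceFinset v \ S v).card : ℝ) = (G.degree v : ℝ) - m v := by
    intro S hS
    have h := (G.mem_outChoices).1 hS v
    rw [Finset.card_sdiff_of_subset h.1, h.2, min_eq_left hv.le, card_incidenceFinset_eq_degree,
      Nat.cast_sub hv.le]
  have hf := G.sum_outChoices_insert hv f
  have h1 : ((G.outChoices m).card : ℝ) * ((G.degree v : ℝ) - m v) =
      (m v + 1) * (G.outChoices m').card := by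
    have h := G.sum_outChoices_insert hv (fun _ => 1)
    simp only [Finset.sum_const, nsmul_eq_mul, mul_one] at h
    rw [← h, Finset.sum_congr rfl hrest, Finset.sum_const, nsmul_eq_mul]
  have hpos : 0 < ((G.outChoices m).card : ℝ) := by
    exact_mod_cast (G.outChoices_nonempty m).card_pos
  have hpos' : 0 < ((G.outChoices m').card : ℝ) := by
    exact_mod_cast (G.outChoices_nonempty m').card_pos
  have hd : 0 < (G.degree v : ℝ) - m v := sub_pos.2 (by exact_mod_cast hv)
  have hsum : ((G.degree v : ℝ) - m v) * ∑ S ∈ G.outChoices m, y S ≤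
      ((G.degree v : ℝ) - m v) * ∑ S ∈ G.outChoices m, f S
        - (m v + 1) * ∑ S ∈ G.outChoices m', f S := by
    rw [← hf, Finset.mul_sum, Finset.mul_sum, ← Finset.sum_sub_distrib]
    refine Finset.sum_le_sum fun S hS => ?_
    have h := hstep S hS
    rw [Finset.sum_sub_distrib, Finset.sum_const, nsmul_eq_mul, hrest S hS] at h
    refine le_trans (mul_le_mul_of_nonneg_right ?_ (hy S)) h
    linarith [(Nat.cast_nonneg (m v) : (0 : ℝ) ≤ m v)]
  have hmean : (∑ S ∈ G.outChoices m', f S) / (G.outChoices m').card =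
      ((m v + 1) * ∑ S ∈ G.outChoices m', f S) /
        (((G.degree v : ℝ) - m v) * (G.outChoices m).card) := by
    rw [mul_comm ((G.degree v : ℝ) - m v), h1, mul_div_mul_left]
    positivity
  unfold outMean
  rw [hmean, ← mul_div_mul_left (∑ S ∈ G.outChoices m, y S) _ hd.ne',
    ← mul_div_mul_left (∑ S ∈ G.outChoices m, f S) _ hd.ne', ← add_div]
  refine div_le_div_of_nonneg_right ?_ (by positivity)
  linarith

end Mean

/-! ### Revealing the choices one edge at a time -/

theorem outSubgraph_mono {V : Type*} (G : SimpleGraph V) {S S' : V → Finset (Sym2 V)} (h : S ≤ S') :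
    G.outSubgraph S ≤ G.outSubgraph S' :=
  fromEdgeSet_mono fun _ he => ⟨he.1, he.2.imp fun v hv => ⟨hv.1, h v hv.2⟩⟩

theorem outSubgraph_adj_of_mem {V : Type*} (G : SimpleGraph V) {S : V → Finset (Sym2 V)}
    {v u : V} (h : G.Adj v u) (hS : s(v, u) ∈ S v) : (G.outSubgraph S).Adj v u := by
  rw [outSubgraph, fromEdgeSet_adj]
  exact ⟨⟨h, v, Sym2.mem_mk_left v u, hS⟩, h.ne⟩

theorem antitone_card_outerNeighbors {V : Type*} [Fintype V] (G : SimpleGraph V)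
    [DecidableRel G.Adj] (v : V) :
    Antitone fun S => ((G.outerNeighbors (G.outSubgraph S) v).card : ℝ) :=
  fun _ _ h => Nat.cast_le.2 (Finset.card_le_card
    (G.outerNeighbors_anti (G.outSubgraph_mono h) v))

theorem le_update_insert {V : Type*} [DecidableEq V] (S : V → Finset (Sym2 V)) (v : V) (e : Sym2 V) :
    S ≤ Function.update S v (insert e (S v)) :=
  le_update_self_iff.2 (Finset.subset_insert _ _)

section Reveal

variable {V : Type*} [Fintype V] [DecidableEq V] (G : SimpleGraph V) [DecidableRel G.Adj]

/-- The next edge of `v` is each of the edges to an outer neighbour with probability at least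
`1 / deg v`, and such an edge lowers the potential by at least `deg v`. -/
theorem outMean_update_potential_add_le (m : V → ℕ) (v : V) :
    G.outMean (Function.update m v (m v + 1)) (fun S => G.potential (G.outSubgraph S)) +
        G.outMean m (fun S => ((G.outerNeighbors (G.outSubgraph S) v).card : ℝ)) ≤
      G.outMean m fun S => G.potential (G.outSubgraph S) := by
  rcases lt_or_ge (m v) (G.degree v) with hv | hv
  · refine G.outMean_update_add_le hv (fun _ => Nat.cast_nonneg _) fun S hS => ?_
    have hinj : Function.Injective fun u => s(v, u) := fun a b h => Sym2.congr_right.1 h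
    have hsub : (G.outerNeighbors (G.outSubgraph S) v).image (fun u => s(v, u)) ⊆
        G.incidenceFinset v \ S v := by
      intro e he
      obtain ⟨u, hu, rfl⟩ := Finset.mem_image.1 he
      rw [mem_outerNeighbors] at hu
      rw [Finset.mem_sdiff, mem_incidenceFinset]
      exact ⟨(G.mem_incidence_iff_neighbor).2 hu.1,
        fun hmem => hu.2.1 (G.outSubgraph_adj_of_mem hu.1 hmem).reachable⟩
    refine le_trans ?_ (Finset.sum_le_sum_of_subset_of_nonneg hsub fun e _ _ =>
      sub_nonneg.2 (G.potential_anti (G.outSubgraph_mono (le_update_insert S v e))))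
    rw [Finset.sum_image hinj.injOn, mul_comm, ← nsmul_eq_mul]
    refine Finset.card_nsmul_le_sum _ _ _ fun u hu => ?_
    rw [mem_outerNeighbors] at hu
    have := G.potential_add_degree_le
      (G.outSubgraph_mono (le_update_insert S v s(v, u))) hu.2.2 hu.2.1
      (G.outSubgraph_adj_of_mem hu.1 (by simp)).reachable
    linarith
  · -- All edges of `v` are chosen already, so nothing changes and `v` has no outer neighbours.
    have hm := G.outChoices_update_of_degree_le hv
    have hzero : G.outMean m (fun S => ((G.outerNeighbors (G.outSubgraph S) v).card : ℝ)) ≤ 0 := by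
      refine (G.outMean_mono (g := fun _ => 0) fun S hS => ?_).trans_eq (G.outMean_const m 0)
      have h := (G.mem_outChoices).1 hS v
      rw [min_eq_right hv, ← card_incidenceFinset_eq_degree] at h
      have hSv : S v = G.incidenceFinset v := Finset.eq_of_subset_of_card_le h.1 h.2.ge
      rw [Nat.cast_nonpos, Finset.card_eq_zero, Finset.eq_empty_iff_forall_notMem]
      intro u hu
      rw [mem_outerNeighbors] at hu
      refine hu.2.1 (G.outSubgraph_adj_of_mem hu.1 ?_).reachable
      rw [hSv, mem_incidenceFinset]
      exact (G.mem_incidence_iff_neighbor).2 hu.1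
    simp only [outMean, hm] at hzero ⊢
    linarith

theorem outMean_update_le {f : (V → Finset (Sym2 V)) → ℝ} (hf : Antitone f) (m : V → ℕ) (v : V) :
    G.outMean (Function.update m v (m v + 1)) f ≤ G.outMean m f := by
  rcases lt_or_ge (m v) (G.degree v) with hv | hv
  · have h := G.outMean_update_add_le hv (f := f) (y := fun _ => 0) (fun _ => le_rfl) fun S _ => by
      rw [mul_zero]
      exact Finset.sum_nonneg fun e _ => sub_nonneg.2 (hf (le_update_insert S v e))
    rwa [outMean_const, add_zero] at h
  · rw [outMean, outMean, G.outChoices_update_of_degree_le hv]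

end Reveal

/-! ### Rounds -/

/-- The sizes of the choices in the middle of a round: the vertices of `A` have chosen `t + 1` edges,
the others `t`. -/
def roundSizes {V : Type*} [DecidableEq V] (t : ℕ) (A : Finset V) (v : V) : ℕ :=
  if v ∈ A then t + 1 else t

theorem roundSizes_insert {V : Type*} [DecidableEq V] (t : ℕ) {A : Finset V} {v : V} (hv : v ∉ A) :
    roundSizes t (insert v A) =
      Function.update (roundSizes t A) v (roundSizes t A v + 1) := by
  ext w
  rcases eq_or_ne w v with rfl | hw
  · simp [roundSizes, hv]
  · simp [roundSizes, hw]

theorem roundSizes_empty {V : Type*} [DecidableEq V] (t : ℕ) :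
    roundSizes t (∅ : Finset V) = fun _ => t := by
  ext w
  simp [roundSizes]

theorem roundSizes_univ {V : Type*} [Fintype V] [DecidableEq V] (t : ℕ) :
    roundSizes t (Finset.univ : Finset V) = fun _ => t + 1 := by
  ext w
  simp [roundSizes]

section Rounds

variable {V : Type*} [Fintype V] [DecidableEq V] (G : SimpleGraph V) [DecidableRel G.Adj]

theorem outMean_succ_le_roundSizes {f : (V → Finset (Sym2 V)) → ℝ} (hf : Antitone f) (t : ℕ)
    (A : Finset V) : G.outMean (fun _ => t + 1) f ≤ G.outMean (roundSizes t A) f := by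
  have h : ∀ B : Finset V, Disjoint B A →
      G.outMean (roundSizes t (B ∪ A)) f ≤ G.outMean (roundSizes t A) f := by
    intro B
    induction B using Finset.induction_on with
    | empty => simp
    | insert v B hv ih =>
      intro hdisj
      rw [Finset.disjoint_insert_left] at hdisj
      rw [Finset.insert_union, roundSizes_insert t (by simp [hv, hdisj.1])]
      exact (G.outMean_update_le hf _ v).trans (ih hdisj.2)
  have h' := h (Finset.univ \ A) Finset.sdiff_disjoint
  rwa [Finset.sdiff_union_of_subset (Finset.subset_univ _), roundSizes_univ] at h'

theorem outMean_succ_le {f : (V → Finset (Sym2 V)) → ℝ} (hf : Antitone f) (t : ℕ) :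
    G.outMean (fun _ => t + 1) f ≤ G.outMean (fun _ => t) f := by
  simpa only [roundSizes_empty] using G.outMean_succ_le_roundSizes hf t ∅

/-- The vertices make their next choices one after the other. The number of outer neighbours of `v`
when its turn comes is at least the number at the end of the round. -/
theorem outMean_succ_potential_add_le (t : ℕ) :
    G.outMean (fun _ => t + 1) (fun S => G.potential (G.outSubgraph S)) +
        G.outMean (fun _ => t + 1)
          (fun S => ∑ v, ((G.outerNeighbors (G.outSubgraph S) v).card : ℝ)) ≤
      G.outMean (fun _ => t) fun S => G.potential (G.outSubgraph S) := by
  have h : ∀ A : Finset V, G.outMean (roundSizes t A) (fun S => G.potential (G.outSubgraph S)) +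
      ∑ v ∈ A, G.outMean (fun _ => t + 1)
        (fun S => ((G.outerNeighbors (G.outSubgraph S) v).card : ℝ)) ≤
      G.outMean (fun _ => t) fun S => G.potential (G.outSubgraph S) := by
    intro A
    induction A using Finset.induction_on with
    | empty => simp [roundSizes_empty]
    | insert v A hv ih =>
      rw [roundSizes_insert t hv, Finset.sum_insert hv]
      have h1 := G.outMean_update_potential_add_le (roundSizes t A) v
      have h2 := G.outMean_succ_le_roundSizes (G.antitone_card_outerNeighbors v) t A
      linarith
  have h' := h Finset.univ
  rwa [roundSizes_univ, ← outMean_sum] at h'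

end Rounds

/-! ### The recursion for the expected potential -/

theorem natCast_le_pow_half {n k : ℕ} (hlog : 9 * Real.log n ≤ k) :
    (n : ℝ) ≤ (3 / 2) ^ (k / 2) := by
  rcases Nat.lt_or_ge n 2 with hn | hn
  · exact le_trans (by exact_mod_cast Nat.le_of_lt_succ hn) (one_le_pow₀ (by norm_num))
  have hn0 : (0 : ℝ) < n := by positivity
  -- `k = 1`, for which `k / 2 = 0`, is excluded by `n ≥ 2`.
  have hk2 : 2 ≤ k := by
    have h2 : Real.log 2 ≤ Real.log n := Real.log_le_log two_pos (by exact_mod_cast hn)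
    have : (1 : ℝ) < k := by linarith [Real.log_two_gt_d9]
    exact_mod_cast this
  have hhalf : (k : ℝ) ≤ 3 * ((k / 2 : ℕ) : ℝ) := by
    have : k ≤ 3 * (k / 2) := by omega
    exact_mod_cast this
  have hbase : (1 / 3 : ℝ) ≤ Real.log (3 / 2) :=
    le_trans (by norm_num) (Real.one_sub_inv_le_log_of_pos (by norm_num))
  rw [← Real.log_le_log_iff hn0 (by positivity), Real.log_pow]
  have := mul_le_mul_of_nonneg_left hbase (Nat.cast_nonneg (α := ℝ) (k / 2))
  linarith

/-- The analytic core: `a` and `x` stand for the expected potential and the expected number of outer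
neighbours after each round. The first `k / 2` rounds bring `a` below `2 * n`, and each of the
remaining ones uses up at least `x k` of that. -/
theorem le_four_mul_div_of_potential {n k : ℕ} (hk : 0 < k) (hlog : 9 * Real.log n ≤ k)
    {a x : ℕ → ℝ} (ha : ∀ t, 0 ≤ a t) (hx : Antitone x) (h0 : a 0 ≤ (n : ℝ) * n)
    (hstep : ∀ t, a (t + 1) + x (t + 1) ≤ a t) (hax : ∀ t, a t ≤ 2 * x t + n) :
    x k ≤ 4 * ((n : ℝ) / k) := by
  have hn : (0 : ℝ) ≤ n := Nat.cast_nonneg n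
  have hdecay : ∀ t, (3 / 2 : ℝ) ^ t * (a t - n) ≤ n * n := by
    intro t
    induction t with
    | zero => linarith
    | succ t ih =>
      refine le_trans ?_ ih
      rw [pow_succ, mul_assoc]
      exact mul_le_mul_of_nonneg_left (by linarith [hstep t, hax (t + 1)]) (by positivity)
  set t := k / 2 with ht
  have hat : a t ≤ 2 * n := by
    by_contra! hlt
    have hpow : (1 : ℝ) ≤ (3 / 2) ^ t := one_le_pow₀ (by norm_num)
    have hlarge : (3 / 2 : ℝ) ^ t * n < (3 / 2) ^ t * (a t - n) :=
      mul_lt_mul_of_pos_left (by linarith) (by linarith)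
    have hsmall := mul_le_mul_of_nonneg_right (natCast_le_pow_half hlog) hn
    linarith [hdecay t]
  have hsum : ∀ j, t + j ≤ k → a (t + j) + j * x k ≤ a t := by
    intro j
    induction j with
    | zero => simp
    | succ j ih =>
      intro hj
      have h1 := ih (by omega)
      have h2 := hstep (t + j)
      have h3 := hx hj
      rw [← add_assoc] at h3 ⊢
      push_cast
      linarith
  have hkt := hsum (k - t) (by omega)
  have hk0 : (0 : ℝ) < k := by exact_mod_cast hk
  have hhalf : (k : ℝ) ≤ 2 * ((k - t : ℕ) : ℝ) := by
    have : k ≤ 2 * (k - t) := by omega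
    exact_mod_cast this
  rw [← mul_div_assoc, le_div_iff₀ hk0]
  rcases le_or_gt (x k) 0 with hxk | hxk
  · exact (mul_nonpos_of_nonpos_of_nonneg hxk hk0.le).trans (by positivity)
  · linarith [ha (t + (k - t)), mul_le_mul_of_nonneg_right hhalf hxk.le]

/-! ### The expectation as a mean over finitely many choices -/

instance {V : Type*} : MeasurableSingletonClass (Finset (Sym2 V)) := ⟨fun _ => trivial⟩

section Expectation

variable {V : Type*} [Fintype V] [DecidableEq V] (G : SimpleGraph V) [DecidableRel G.Adj]

theorem kOutMeasure_real_singleton (k : ℕ) (S : V → Finset (Sym2 V)) :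
    (G.kOutMeasure k).real {S} =
      if S ∈ G.outChoices (fun _ => k) then ((G.outChoices fun _ => k).card : ℝ)⁻¹ else 0 := by
  rw [Measure.real, kOutMeasure, Measure.pi_singleton]
  simp only [PMF.toMeasure_apply_singleton _ _ (MeasurableSet.singleton _),
    PMF.uniformOfFinset_apply]
  split_ifs with hS
  · rw [outChoices, Fintype.mem_piFinset] at hS
    simp only [hS, if_true, ENNReal.toReal_prod, ENNReal.toReal_inv, ENNReal.toReal_natCast,
      outChoices, Fintype.card_piFinset, Nat.cast_prod, Finset.prod_inv_distrib]
  · rw [outChoices, Fintype.mem_piFinset, not_forall] at hS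
    obtain ⟨v, hv⟩ := hS
    rw [Finset.prod_eq_zero (Finset.mem_univ v) (if_neg hv), ENNReal.toReal_zero]

theorem integral_kOutMeasure (k : ℕ) (f : (V → Finset (Sym2 V)) → ℝ) :
    ∫ S, f S ∂(G.kOutMeasure k) = G.outMean (fun _ => k) f := by
  have : IsFiniteMeasure (G.kOutMeasure k) := by
    unfold kOutMeasure
    infer_instance
  rw [integral_fintype Integrable.of_finite]
  simp only [kOutMeasure_real_singleton, smul_eq_mul, ite_mul, zero_mul, Finset.sum_ite_mem,
    Finset.univ_inter]
  rw [outMean, ← Finset.mul_sum, inv_mul_eq_div]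

theorem expectedInterComponentEdges_le {k : ℕ} (hk : 0 < k)
    (hlog : 9 * Real.log (Fintype.card V) ≤ k) :
    G.expectedInterComponentEdges k ≤ 4 * ((Fintype.card V : ℝ) / k) := by
  rw [expectedInterComponentEdges, integral_kOutMeasure]
  refine (G.outMean_mono fun S _ => ?_).trans (le_four_mul_div_of_potential hk hlog
    (a := fun t => G.outMean (fun _ => t) fun S => G.potential (G.outSubgraph S))
    (x := fun t => G.outMean (fun _ => t)
      fun S => ∑ v, ((G.outerNeighbors (G.outSubgraph S) v).card : ℝ))
    (fun t => ?_) (antitone_nat_of_succ_le fun t => G.outMean_succ_le ?_ t) ?_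
    G.outMean_succ_potential_add_le fun t => ?_)
  · exact_mod_cast G.ncard_interComponentEdges_le (G.outSubgraph S)
  · exact (G.outMean_const _ 0).symm.trans_le (G.outMean_mono fun S _ => G.potential_nonneg _)
  · exact fun S S' h => Finset.sum_le_sum fun v _ => G.antitone_card_outerNeighbors v h
  · exact (G.outMean_mono fun S _ => G.potential_le_sq _).trans_eq (G.outMean_const _ _)
  · refine (G.outMean_mono fun S _ =>
      G.potential_le_two_mul_sum_outerNeighbors (G.outSubgraph S)).trans_eq ?_
    rw [outMean_add, outMean_const_mul, outMean_const]

end Expectation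

end SimpleGraph

theorem theorem1 :
    ∃ c C : ℝ, 0 < c ∧ 0 < C ∧
      ∀ (V : Type*) [Fintype V] [DecidableEq V] (G : SimpleGraph V) [DecidableRel G.Adj] (k : ℕ),
        0 < k → c * Real.log (Fintype.card V) ≤ (k : ℝ) →
          G.expectedInterComponentEdges k ≤ C * ((Fintype.card V : ℝ) / (k : ℝ)) := by
  refine ⟨9, 4, by norm_num, by norm_num, ?_⟩
  intro V _ _ G _ k hk hlog
  exact G.expectedInterComponentEdges_le hk hlog
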